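/- Call a family of subsets of a set a $\sigma$-ideal if it is closed under taking subsets and under countable unions (including the empty union, so it contains $\emptyset$). For $R \subseteq A \times B$ and $a \in A$ write $R_a = \{b \in B : (a,b) \in R\}$. A Borel equivalence relation $F$ on a Polish space $Y$ is strongly idealistic if there is an assignment $y \mapsto \mathcal{I}_y$ of a $\sigma$-ideal on $Y$ to each point of $Y$ such that: $\mathcal{I}_y = \mathcal{I}_{y'}$ whenever $y \mathrel{F} y'$; the class $[y]_F$ is not in $\mathcal{I}_y$ for every $y \in Y$; and for every Polish space $Z$ and every Borel set $S \subseteq (Y \times Z) \times Y$, the set $\{(y,z) \in Y \times Z : S_{(y,z)} \in \mathcal{I}_y\}$ is Borel. Theorem. Suppose that $X$ and $Y$ are Polish spaces, $F$ is a strongly idealistic Borel equivalence relation on $Y$, and $R \subseteq X \times Y$ is a Borel set such that, for every $x \in X$, the vertical section $R_x$ is a union of countably many (possibly zero) $F$-classes. Then $\mathrm{proj}_X(R)$ is Borel, and there are Borel maps $\phi_n \colon \mathrm{proj}_X(R) \to Y$, for $n \in \mathbb{N}$, such that $R_x = \bigcup_{n \in \mathbb{N}} [\phi_n(x)]_F$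 for all $x \in \mathrm{proj}_X(R)$. -/

import Mathlib

namespace BorelQuotient

/-- A family of subsets of `X` closed under containment and countable unions
(including the union of the empty family, so that `∅` belongs to it). -/
structure IsSigmaIdeal {X : Type*} (I : Set (Set X)) : Prop where
  empty_mem : ∅ ∈ I
  mem_of_subset : ∀ {A B : Set X}, B ∈ I → A ⊆ B → A ∈ I
  iUnion_mem : ∀ A : ℕ → Set X, (∀ n, A n ∈ I) → (⋃ n, A n) ∈ I

/-- The vertical section `R_x = {y | (x, y) ∈ R}`. -/
def verticalSection {X Y : Type*} (R : Set (X × Y)) (x : X) : Set Y :=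
  {y | (x, y) ∈ R}

/-- The equivalence class `[x]_E`. -/
def eqClass {X : Type*} (E : Setoid X) (x : X) : Set X :=
  {y | E y x}

/-- An equivalence relation is Borel if it is a Borel subset of the square. -/
def IsBorelEquiv {X : Type*} [MeasurableSpace X] (E : Setoid X) : Prop :=
  MeasurableSet {p : X × X | E p.1 p.2}

/-- An assignment `x ↦ I x` of families of subsets of `X` is strongly Borel-on-Borel if
`{(x, z) | R_(x, z) ∈ I x}` is Borel for all Polish spaces `Z` and Borel `R ⊆ (X × Z) × X`.
Every Polish space is Borel isomorphic to one in `Type`; see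
`StronglyBorelOnBorel.measurableSet` for test spaces in an arbitrary universe. -/
def StronglyBorelOnBorel {X : Type*} [MeasurableSpace X] (I : X → Set (Set X)) : Prop :=
  ∀ (Z : Type) [TopologicalSpace Z] [PolishSpace Z] [MeasurableSpace Z] [BorelSpace Z]
    (R : Set ((X × Z) × X)), MeasurableSet R →
      MeasurableSet {p : X × Z | verticalSection R p ∈ I p.1}

/-- The test spaces in the definition may be taken in any universe. -/
theorem StronglyBorelOnBorel.measurableSet {X : Type*} [MeasurableSpace X]
    {I : X → Set (Set X)} (hI : StronglyBorelOnBorel I)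
    (Z : Type*) [TopologicalSpace Z] [PolishSpace Z] [MeasurableSpace Z] [BorelSpace Z]
    (R : Set ((X × Z) × X)) (hR : MeasurableSet R) :
    MeasurableSet {p : X × Z | verticalSection R p ∈ I p.1} := by
  obtain ⟨f, hf⟩ := MeasureTheory.exists_measurableEmbedding_real Z
  have hg : MeasurableEmbedding (Prod.map (Prod.map id f) id : (X × Z) × X → (X × ℝ) × X) :=
    (MeasurableEmbedding.id.prodMap hf).prodMap MeasurableEmbedding.id
  have h := hI ℝ _ (hg.measurableSet_image.2 hR)
  have hm : Measurable (Prod.map id f : X × Z → X × ℝ) := measurable_id.prodMap hf.measurable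
  convert hm h using 1
  ext ⟨x, z⟩
  have : verticalSection (Prod.map (Prod.map id f) id '' R) (x, f z)
      = verticalSection R (x, z) := by
    ext w
    simp only [verticalSection, Set.mem_ofPred_eq]
    exact hg.injective.mem_set_image (a := ((x, z), w))
  simp [this]

/-- A Borel equivalence relation `E` is strongly idealistic if there is an `E`-invariant
strongly Borel-on-Borel assignment of σ-ideals `x ↦ I x` with `[x]_E ∉ I x`. -/
def IsStronglyIdealistic {X : Type*} [MeasurableSpace X] (E : Setoid X) : Prop :=
  ∃ I : X → Set (Set X),
    (∀ x, IsSigmaIdeal (I x)) ∧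
    (∀ x y, E x y → I x = I y) ∧
    StronglyBorelOnBorel I ∧
    ∀ x, eqClass E x ∉ I x

end BorelQuotient

open Set Filter Topology MeasureTheory

namespace BorelQuotient

/-! Join two points of `R` over the same `x` when their second coordinates are `F`-inequivalent. By
a dichotomy of Kechris–Solecki–Todorcevic type (`exists_cover_isIndependent_or_exists_continuous`),
either countably many Borel independent sets cover `X × Y`, or the graph receives a continuous
homomorphism from the graph `G₀` on Cantor space, whose edges join `glue (false :: s n) c` to `glue
(true :: s n) c`. In the second case the first coordinate is constant, so a single `R_x` absorbs all
edges. Its countably many classes, pulled back, together with the preimage of the complement of `R`,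
partition Cantor space into countably many Borel sets. One of these is nonmeagre and so contains an
edge, which is absurd. Hence `R` is a countable union of Borel sets with sections inside single
classes, and iterated analytic separation enlarges each so that its nonempty sections are full
classes.

The ideals then select a point of each such class (`exists_uniformization_of_class_sections`): along
finer and finer countable covers, keep the first piece that is positive for the ideal. Invariance
makes the limit point independent of the representative of the class, and the Borel-on-Borel
condition makes the selection Borel. Projections of the resulting graphs are Borel by Lusin–Souslin.
-/

/-! ### Binary sequences

Finite binary sequences are lists whose head is the last term of the sequence. -/

/-- Prepend a bit to an infinite binary sequence. -/
def bitCons (i : Bool) (c : ℕ → Bool) : ℕ → Bool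
  | 0 => i
  | n + 1 => c n

/-- The infinite sequence obtained by following the finite sequence `t` (read from its last
entry to its head) by `c`. -/
def glue : List Bool → (ℕ → Bool) → (ℕ → Bool)
  | [], c => c
  | i :: t, c => glue t (bitCons i c)

/-- The first `n` terms of `c`, the last of them at the head. -/
def initSeg (c : ℕ → Bool) : ℕ → List Bool
  | 0 => []
  | n + 1 => c n :: initSeg c n

@[simp] theorem length_initSeg (c : ℕ → Bool) (n : ℕ) : (initSeg c n).length = n := by
  induction n with
  | zero => rfl
  | succ n ih => simp [initSeg, ih]

theorem initSeg_bitCons (i : Bool) (c : ℕ → Bool) (m : ℕ) :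
    initSeg (bitCons i c) (m + 1) = initSeg c m ++ [i] := by
  induction m with
  | zero => rfl
  | succ m ih => rw [initSeg, ih]; rfl

theorem initSeg_glue (t : List Bool) (c : ℕ → Bool) (m : ℕ) :
    initSeg (glue t c) (t.length + m) = initSeg c m ++ t := by
  induction t generalizing c m with
  | nil => simp [glue]
  | cons i t ih =>
    have : (i :: t).length + m = t.length + (m + 1) := by simp; omega
    rw [this, glue, ih, initSeg_bitCons]
    simp

theorem glue_append (u t : List Bool) (c : ℕ → Bool) :
    glue (u ++ t) c = glue t (glue u c) := by
  induction u generalizing c with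
  | nil => rfl
  | cons i u ih => exact ih _

theorem glue_initSeg (c : ℕ → Bool) (n : ℕ) :
    glue (initSeg c n) (fun m => c (n + m)) = c := by
  induction n with
  | zero => simp [initSeg, glue]
  | succ n ih =>
    rw [initSeg, glue]
    convert ih using 2
    ext m
    cases m with
    | zero => rfl
    | succ m => simp [bitCons, add_assoc, add_comm 1 m]

theorem eq_of_initSeg_eq {c c' : ℕ → Bool} {n : ℕ} (h : initSeg c n = initSeg c' n) :
    ∀ k < n, c k = c' k := by
  induction n with
  | zero => simp
  | succ n ih =>
    simp only [initSeg, List.cons.injEq] at h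
    intro k hk
    rcases Nat.lt_succ_iff_lt_or_eq.1 hk with hk | rfl
    · exact ih h.2 k hk
    · exact h.1

theorem tendsto_of_initSeg_eq {u : ℕ → ℕ → Bool} {c : ℕ → Bool}
    (h : ∀ n, initSeg (u n) n = initSeg c n) : Tendsto u atTop (𝓝 c) := by
  rw [tendsto_pi_nhds]
  intro k
  refine tendsto_const_nhds.congr' ?_
  filter_upwards [eventually_gt_atTop k] with n hn
  exact (eq_of_initSeg_eq (h n) k hn).symm

theorem tendsto_glue_initSeg (c : ℕ → Bool) (d : ℕ → ℕ → Bool) :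
    Tendsto (fun n => glue (initSeg c n) (d n)) atTop (𝓝 c) := by
  refine tendsto_of_initSeg_eq fun n => ?_
  simpa [initSeg] using initSeg_glue (initSeg c n) (d n) 0

theorem continuous_bitCons (i : Bool) : Continuous (bitCons i) := by
  refine continuous_pi fun n => ?_
  cases n with
  | zero => exact continuous_const
  | succ n => exact continuous_apply n

theorem isOpenMap_bitCons (i : Bool) : IsOpenMap (bitCons i) := by
  intro U hU
  have : bitCons i '' U = {c | c 0 = i} ∩ (fun c : ℕ → Bool => fun n => c (n + 1)) ⁻¹' U := by
    ext c
    constructor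
    · rintro ⟨d, hd, rfl⟩
      exact ⟨rfl, hd⟩
    · rintro ⟨h0, hc⟩
      refine ⟨_, hc, ?_⟩
      ext n
      cases n with
      | zero => exact h0.symm
      | succ n => rfl
  rw [this]
  have h0 : Continuous fun c : ℕ → Bool => c 0 := continuous_apply 0
  have hs : Continuous fun c : ℕ → Bool => fun n => c (n + 1) :=
    continuous_pi fun n => continuous_apply (n + 1)
  exact ((isOpen_discrete {i}).preimage h0).inter (hU.preimage hs)

theorem continuous_glue (t : List Bool) : Continuous (glue t) := by
  induction t with
  | nil => exact continuous_id
  | cons i t ih => exact ih.comp (continuous_bitCons i)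

theorem isOpenMap_glue (t : List Bool) : IsOpenMap (glue t) := by
  induction t with
  | nil => exact IsOpenMap.id
  | cons i t ih => exact ih.comp (isOpenMap_bitCons i)

theorem exists_dense_seq :
    ∃ s : ℕ → List Bool, (∀ n, (s n).length = n) ∧ ∀ t, ∃ n u, s n = u ++ t := by
  refine ⟨fun n => (fun t : List Bool => if t.length ≤ n
    then List.replicate (n - t.length) false ++ t else List.replicate n false)
    ((Encodable.decode n.unpair.1).getD []), fun n => ?_, fun t => ?_⟩
  · dsimp only
    split_ifs with h
    · simp; omega
    · simp
  -- The second component forces `t.length ≤ n`, leaving room to pad `t` to length `n`.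
  · refine ⟨Nat.pair (Encodable.encode t) t.length, ?_⟩
    simp only [Nat.unpair_pair, Encodable.encodek, Option.getD_some]
    rw [if_pos (Nat.right_le_pair _ _)]
    exact ⟨_, rfl⟩

/-- By Baire category some `A i` is nonmeagre, hence comeagre in a basic open set; choose `s n`
extending its defining word. Both maps `c ↦ glue (j :: s n) c` are continuous and open, so `A i`
pulls back to comeagre sets, which meet. -/
theorem exists_glue_mem_of_cover {s : ℕ → List Bool} (hs : ∀ t, ∃ n u, s n = u ++ t)
    {ι : Type*} [Countable ι] {A : ι → Set (ℕ → Bool)} (hA : ∀ i, MeasurableSet (A i))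
    (hcov : ⋃ i, A i = univ) :
    ∃ i n c, glue (false :: s n) c ∈ A i ∧ glue (true :: s n) c ∈ A i := by
  have hnon : ¬ ∀ i, IsMeagre (A i) := by
    intro h
    have := isMeagre_iUnion h
    rw [hcov] at this
    exact not_isMeagre_of_isOpen isOpen_univ univ_nonempty this
  push Not at hnon
  obtain ⟨i, hi⟩ := hnon
  obtain ⟨U, hU, hAU⟩ := (hA i).residualEq_isOpen
  have hne : U.Nonempty := by
    by_contra hU0
    rw [not_nonempty_iff_eq_empty] at hU0
    subst hU0
    refine hi ?_
    rw [eventuallyEq_empty] at hAU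
    exact hAU
  obtain ⟨c₀, hc₀⟩ := hne
  obtain ⟨m, hm⟩ : ∃ m, ∀ d, glue (initSeg c₀ m) d ∈ U := by
    by_contra! hcon
    choose d hd using hcon
    obtain ⟨m, hm⟩ := ((tendsto_glue_initSeg c₀ d).eventually (hU.mem_nhds hc₀)).exists
    exact hd m hm
  obtain ⟨n, u, hn⟩ := hs (initSeg c₀ m)
  have key : ∀ j : Bool, ∀ᶠ c in residual (ℕ → Bool), glue (j :: s n) c ∈ A i := by
    intro j
    filter_upwards [(tendsto_residual_of_isOpenMap (continuous_glue (j :: s n))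
      (isOpenMap_glue (j :: s n))).eventually hAU.mem_iff] with c hc
    rw [hc, hn, ← List.cons_append, glue_append]
    exact hm _
  obtain ⟨c, hc⟩ := (dense_of_mem_residual ((key false).and (key true))).nonempty
  exact ⟨i, n, c, hc⟩

/-! ### A dichotomy for Borel graphs -/

/-- A set is independent for the graph `G` if it contains no edge of `G`. -/
def IsIndependent {W : Type*} (G : Set (W × W)) (A : Set W) : Prop :=
  ∀ a ∈ A, ∀ b ∈ A, (a, b) ∉ G

/-! ### Enlarging analytic independent sets to Borel ones -/

section Separation

variable {W : Type*} [TopologicalSpace W] [PolishSpace W] [MeasurableSpace W] [BorelSpace W]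

theorem analyticSet_relImage {H : Set (W × W)} (hH : MeasurableSet H) {A : Set W}
    (hA : AnalyticSet A) : AnalyticSet (Prod.snd '' (H ∩ Prod.fst ⁻¹' A)) := by
  refine AnalyticSet.image_of_continuous ?_ continuous_snd
  rw [inter_eq_iInter]
  refine AnalyticSet.iInter fun b => ?_
  cases b
  · exact hA.preimage continuous_fst
  · exact hH.analyticSet

/-- Lusin separation is used twice: `B` separates `A` from the neighbours of `A`, and then, by
symmetry of `G`, `B'` can separate `A` from the neighbours of `B`. No edge leads from `B` to `B'`.
-/
theorem exists_measurableSet_isIndependent_superset {G : Set (W × W)} (hG : MeasurableSet G)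
    (hsymm : ∀ a b, (a, b) ∈ G → (b, a) ∈ G) {A : Set W} (hA : AnalyticSet A)
    (hind : IsIndependent G A) : ∃ B, A ⊆ B ∧ MeasurableSet B ∧ IsIndependent G B := by
  obtain ⟨B, hAB, hBd, hB⟩ := hA.measurablySeparable (analyticSet_relImage hG hA) (by
    rw [Set.disjoint_left]
    rintro b hb ⟨⟨a, b'⟩, ⟨hab, ha⟩, rfl⟩
    exact hind a ha b' hb hab)
  obtain ⟨B', hAB', hBd', hB'⟩ := hA.measurablySeparable
    (analyticSet_relImage hG hB.analyticSet) (by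
    rw [Set.disjoint_left]
    rintro a ha ⟨⟨b, a'⟩, ⟨hba, hb⟩, rfl⟩
    exact Set.disjoint_left.1 hBd ⟨(a', b), ⟨hsymm _ _ hba, ha⟩, rfl⟩ hb)
  refine ⟨B ∩ B', subset_inter hAB hAB', hB.inter hB', ?_⟩
  rintro a ⟨ha, -⟩ b ⟨-, hb⟩ hab
  exact Set.disjoint_left.1 hBd' ⟨(a, b), ⟨hab, ha⟩, rfl⟩ hb

end Separation

/-! ### Finite configurations approximating a homomorphism -/

section Small

variable {W : Type*} [MeasurableSpace W]

/-- A set `Q` of configurations is small at level `n` if countably many Borel independent sets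
suffice to meet each configuration in `Q` in one of its vertices of level `n`. -/
def IsSmall (G : Set (W × W)) (n : ℕ) (Q : Set (List Bool → W × (ℕ → ℕ))) : Prop :=
  ∃ B : ℕ → Set W, (∀ i, MeasurableSet (B i) ∧ IsIndependent G (B i)) ∧
    ∀ q ∈ Q, ∃ t : List Bool, t.length = n ∧ ∃ i, (q t).1 ∈ B i

theorem isSmall_iUnion {G : Set (W × W)} {n : ℕ} {Q : ℕ → Set (List Bool → W × (ℕ → ℕ))}
    (h : ∀ k, IsSmall G n (Q k)) : IsSmall G n (⋃ k, Q k) := by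
  choose B hB hQ using h
  refine ⟨fun m => B m.unpair.1 m.unpair.2, fun m => hB _ _, fun q hq => ?_⟩
  obtain ⟨k, hk⟩ := mem_iUnion.1 hq
  obtain ⟨t, ht, i, hi⟩ := hQ k q hk
  exact ⟨t, ht, Nat.pair k i, by simpa using hi⟩

theorem IsSmall.nonempty_of_not {G : Set (W × W)} {n : ℕ} {Q : Set (List Bool → W × (ℕ → ℕ))}
    (h : ¬ IsSmall G n Q) : Q.Nonempty := by
  by_contra hQ
  rw [not_nonempty_iff_eq_empty] at hQ
  exact h ⟨fun _ => ∅, fun _ => ⟨MeasurableSet.empty, fun a ha => ha.elim⟩, by simp [hQ]⟩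

end Small

/-- The configurations of the next level both of whose halves lie in `Q` and whose halves are
joined by the edge of `G` with code given at `[]`, where `g` parametrizes `G`. -/
def extend {W : Type*} (g : (ℕ → ℕ) → W × W) (s : List Bool)
    (Q : Set (List Bool → W × (ℕ → ℕ))) : Set (List Bool → W × (ℕ → ℕ)) :=
  {q | (∀ i, (fun t => q (i :: t)) ∈ Q) ∧
    g (q []).2 = ((q (false :: s)).1, (q (true :: s)).1)}

section Step

variable {W : Type*} [TopologicalSpace W] [PolishSpace W] [MeasurableSpace W] [BorelSpace W]

theorem measurableSet_extend {g : (ℕ → ℕ) → W × W} (hg : Continuous g) (s : List Bool)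
    {Q : Set (List Bool → W × (ℕ → ℕ))} (hQ : MeasurableSet Q) :
    MeasurableSet (extend g s Q) := by
  have h1 : ∀ i : Bool, MeasurableSet {q : List Bool → W × (ℕ → ℕ) |
      (fun t => q (i :: t)) ∈ Q} := fun i =>
    (measurable_pi_lambda (fun (q : List Bool → W × (ℕ → ℕ)) t => q (i :: t))
      fun t => measurable_pi_apply (i :: t)) hQ
  have h2 : MeasurableSet {q : List Bool → W × (ℕ → ℕ) |
      g (q []).2 = ((q (false :: s)).1, (q (true :: s)).1)} := by
    refine IsClosed.measurableSet (isClosed_eq (by fun_prop) (by fun_prop))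
  have : extend g s Q = (⋂ i : Bool, {q | (fun t => q (i :: t)) ∈ Q}) ∩
      {q | g (q []).2 = ((q (false :: s)).1, (q (true :: s)).1)} := by
    ext q
    simp [extend]
  rw [this]
  exact (MeasurableSet.iInter h1).inter h2

/-- If sets `B i` witnessed smallness of the extension, discard from `Q` the configurations that
meet them at level `n`. The vertices at `s` of the remaining ones are independent, since an edge
would glue two of them into an extension missing every `B i`. A Borel independent superset of these
vertices, together with the `B i`, makes `Q` small. -/
theorem not_isSmall_extend {G : Set (W × W)} (hG : MeasurableSet G)
    (hsymm : ∀ a b, (a, b) ∈ G → (b, a) ∈ G) {g : (ℕ → ℕ) → W × W} (hgG : range g = G)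
    {n : ℕ} {s : List Bool} (hs : s.length = n)
    {Q : Set (List Bool → W × (ℕ → ℕ))} (hQ : MeasurableSet Q) (hQn : ¬ IsSmall G n Q) :
    ¬ IsSmall G (n + 1) (extend g s Q) := by
  rintro ⟨B, hB, hQB⟩
  set Q₀ : Set (List Bool → W × (ℕ → ℕ)) :=
    Q ∩ ⋂ t : {t : List Bool // t.length = n}, {q | (q t).1 ∈ (⋃ i, B i)ᶜ} with hQ₀
  have hQ₀m : MeasurableSet Q₀ := by
    refine hQ.inter (MeasurableSet.iInter fun t => ?_)
    exact (measurable_fst.comp (measurable_pi_apply (t : List Bool)))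
      (MeasurableSet.iUnion fun i => (hB i).1).compl
  have : BorelSpace (List Bool → W × (ℕ → ℕ)) := Pi.borelSpace
  have hA : AnalyticSet ((fun q : List Bool → W × (ℕ → ℕ) => (q s).1) '' Q₀) :=
    hQ₀m.analyticSet.image_of_continuous (continuous_fst.comp (continuous_apply s))
  have havoid : ∀ q ∈ Q₀, ∀ t : List Bool, t.length = n → ∀ i, (q t).1 ∉ B i := by
    intro q hq t ht i hi
    have := mem_iInter.1 hq.2 ⟨t, ht⟩
    exact this (mem_iUnion.2 ⟨i, hi⟩)
  obtain ⟨A, hsub, hAm, hAi⟩ := exists_measurableSet_isIndependent_superset hG hsymm hA (by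
    rintro _ ⟨a, ha, rfl⟩ _ ⟨b, hb, rfl⟩ hab
    rw [← hgG] at hab
    obtain ⟨d, hd⟩ := hab
    -- Only the code `d` matters at `[]`; the `W`-entry there is a filler, as vertices of level `n +
    -- 1` sit at longer words.
    let q : List Bool → W × (ℕ → ℕ) := fun t => match t with
      | [] => ((a []).1, d)
      | false :: t => a t
      | true :: t => b t
    have hq : q ∈ extend g s Q := by
      refine ⟨fun i => ?_, hd⟩
      cases i
      · exact ha.1
      · exact hb.1
    obtain ⟨t, ht, i, hi⟩ := hQB q hq
    match t, ht with
    | false :: t, ht => exact havoid a ha t (by simpa using ht) i hi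
    | true :: t, ht => exact havoid b hb t (by simpa using ht) i hi)
  refine hQn ⟨fun k => Nat.casesOn k A B, fun k => ?_, fun q hq => ?_⟩
  · cases k with
    | zero => exact ⟨hAm, hAi⟩
    | succ k => exact hB k
  · by_cases hq₀ : q ∈ Q₀
    · exact ⟨s, hs, 0, hsub ⟨q, hq₀, rfl⟩⟩
    · simp only [hQ₀, mem_inter_iff, hq, true_and, mem_iInter, not_forall] at hq₀
      obtain ⟨t, ht⟩ := hq₀
      have ht' : (q t).1 ∈ ⋃ i, B i := by
        by_contra h
        exact ht h
      obtain ⟨i, hi⟩ := mem_iUnion.1 ht'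
      exact ⟨t, t.2, i + 1, hi⟩

end Step

/-- Small sets are closed under countable unions, so for each word in turn one of countably many
balls of radius `ε / 2` retains a non-small part. -/
theorem exists_not_isSmall_dist_le {W : Type*} [MeasurableSpace W] {G : Set (W × W)} {n : ℕ}
    [MetricSpace (W × (ℕ → ℕ))] [SecondCountableTopology (W × (ℕ → ℕ))]
    [OpensMeasurableSpace (W × (ℕ → ℕ))]
    {ε : ℝ} (hε : 0 < ε) {T : Set (List Bool)} (hT : T.Finite)
    {Q : Set (List Bool → W × (ℕ → ℕ))} (hQ : MeasurableSet Q) (hQn : ¬ IsSmall G n Q) :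
    ∃ Q' ⊆ Q, MeasurableSet Q' ∧ ¬ IsSmall G n Q' ∧
      ∀ t ∈ T, ∀ q ∈ Q', ∀ q' ∈ Q', dist (q t) (q' t) ≤ ε := by
  induction T, hT using Set.Finite.induction_on with
  | empty => exact ⟨Q, Subset.rfl, hQ, hQn, by simp⟩
  | @insert t T _ _ ih =>
    obtain ⟨Q', hQQ', hQ', hQn', hd⟩ := ih
    obtain ⟨q₀, -⟩ := IsSmall.nonempty_of_not hQn
    have : Nonempty (W × (ℕ → ℕ)) := ⟨q₀ []⟩
    let v := TopologicalSpace.denseSeq (W × (ℕ → ℕ))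
    obtain ⟨k, hk⟩ : ∃ k, ¬ IsSmall G n (Q' ∩ {q | q t ∈ Metric.ball (v k) (ε / 2)}) := by
      by_contra! h
      refine hQn' ?_
      convert isSmall_iUnion h using 1
      rw [← inter_iUnion]
      refine (inter_eq_left.2 fun q _ => ?_).symm
      obtain ⟨k, hx⟩ := (TopologicalSpace.denseRange_denseSeq _).exists_mem_open
        (Metric.isOpen_ball (x := q t) (ε := ε / 2)) ⟨q t, Metric.mem_ball_self (half_pos hε)⟩
      exact mem_iUnion.2 ⟨k, by simpa [Metric.mem_ball, dist_comm] using hx⟩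
    refine ⟨_, inter_subset_left.trans hQQ', hQ'.inter
      (measurable_pi_apply t Metric.isOpen_ball.measurableSet), hk, ?_⟩
    rintro u (rfl | hu) q ⟨hq, hqt⟩ q' ⟨hq', hqt'⟩
    · refine (dist_triangle_right _ _ (v k)).trans ?_
      have h1 : dist (q u) (v k) < ε / 2 := hqt
      have h2 : dist (q' u) (v k) < ε / 2 := hqt'
      linarith
    · exact hd u hu q hq q' hq'

theorem append_mem_of_forall_mem_extend {W : Type*} {g : (ℕ → ℕ) → W × W} {s : ℕ → List Bool}
    {Q : ℕ → Set (List Bool → W × (ℕ → ℕ))} (hQ : ∀ n, Q (n + 1) ⊆ extend g (s n) (Q n))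
    (t : List Bool) {n : ℕ} {q : List Bool → W × (ℕ → ℕ)} (hq : q ∈ Q (n + t.length)) :
    (fun l => q (t ++ l)) ∈ Q n := by
  induction t generalizing q with
  | nil => exact hq
  | cons i t ih => exact ih ((hQ _ hq).1 i)

/-- Either a Polish space is covered by countably many Borel sets which are independent for the
Borel graph `G`, or `G` admits a continuous homomorphism from the graph on the Cantor space
determined by `s`. -/
theorem exists_cover_isIndependent_or_exists_continuous {W : Type*} [TopologicalSpace W]
    [PolishSpace W] [MeasurableSpace W] [BorelSpace W] {G : Set (W × W)} (hG : MeasurableSet G)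
    (hsymm : ∀ a b, (a, b) ∈ G → (b, a) ∈ G) {s : ℕ → List Bool} (hs : ∀ n, (s n).length = n) :
    (∃ B : ℕ → Set W, (∀ i, MeasurableSet (B i) ∧ IsIndependent G (B i)) ∧ ⋃ i, B i = univ) ∨
    ∃ φ : (ℕ → Bool) → W, Continuous φ ∧
      ∀ n c, (φ (glue (false :: s n) c), φ (glue (true :: s n) c)) ∈ G := by
  by_cases hsmall : IsSmall G 0 univ
  · left
    obtain ⟨B, hB, h⟩ := hsmall
    refine ⟨B, hB, eq_univ_of_forall fun w => ?_⟩
    obtain ⟨t, -, i, hi⟩ := h (fun _ => (w, fun _ => 0)) (mem_univ _)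
    exact mem_iUnion.2 ⟨i, hi⟩
  right
  have hGa := hG.analyticSet
  rw [AnalyticSet] at hGa
  obtain rfl | ⟨g, hg, hgG⟩ := hGa
  · exact absurd ⟨fun _ => univ, fun _ => ⟨MeasurableSet.univ, fun _ _ _ _ => id⟩,
      fun q _ => ⟨[], rfl, 0, mem_univ _⟩⟩ hsmall
  let _ := TopologicalSpace.upgradeIsCompletelyMetrizable (W × (ℕ → ℕ))
  let P : ℕ → Set (List Bool → W × (ℕ → ℕ)) → Prop := fun n Q =>
    MeasurableSet Q ∧ ¬ IsSmall G n Q ∧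
      ∀ t ∈ {t : List Bool | t.length ≤ n}, ∀ q ∈ Q, ∀ q' ∈ Q, dist (q t) (q' t) ≤ (1 / 2) ^ n
  obtain ⟨Q₀, -, hQ₀⟩ := exists_not_isSmall_dist_le (ε := (1 / 2) ^ 0) (by positivity)
    (List.finite_length_le Bool 0) MeasurableSet.univ hsmall
  have step : ∀ n (Q : {Q // P n Q}), ∃ Q' : {Q // P (n + 1) Q}, Q'.1 ⊆ extend g (s n) Q.1 := by
    rintro n ⟨Q, hQ, hQn, -⟩
    obtain ⟨Q', hsub, hQ'⟩ := exists_not_isSmall_dist_le (ε := (1 / 2) ^ (n + 1)) (by positivity)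
      (List.finite_length_le Bool (n + 1)) (measurableSet_extend hg (s n) hQ)
      (not_isSmall_extend hG hsymm hgG (hs n) hQ hQn)
    exact ⟨⟨Q', hQ'⟩, hsub⟩
  choose next hnext using step
  let Q : ∀ n, {Q // P n Q} := fun n => Nat.rec ⟨Q₀, hQ₀⟩ next n
  have hQ : ∀ n, (Q (n + 1)).1 ⊆ extend g (s n) (Q n).1 := fun n => hnext n (Q n)
  choose q hq using fun n => IsSmall.nonempty_of_not (Q n).2.2.1
  -- Each half of `q (n + 1)` lies in `Q n`, whose entries at words of length at most `n` vary by at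
  -- most `(1 / 2) ^ n`.
  have hdist : ∀ (t : List Bool) (i : Bool) (n : ℕ), t.length ≤ n →
      dist (q n t) (q (n + 1) (i :: t)) ≤ (1 / 2) ^ n := fun t i n ht =>
    (Q n).2.2.2 t ht _ (hq n) _ ((hQ n (hq (n + 1))).1 i)
  have hlim : ∀ c, ∃ w, Tendsto (fun n => q n (initSeg c n)) atTop (𝓝 w) := fun c =>
    cauchySeq_tendsto_of_complete (cauchySeq_of_le_geometric (1 / 2) 1 (by norm_num)
      fun n => by
        rw [one_mul]
        exact hdist (initSeg c n) (c n) n (length_initSeg c n).le)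
  choose Φ hΦ using hlim
  have hΦcont : Continuous Φ := by
    refine TendstoUniformly.continuous (F := fun n c => q n (initSeg c n)) (p := atTop) ?_
      (Frequently.of_forall fun n => ?_)
    · rw [Metric.tendstoUniformly_iff]
      intro ε hε
      have h0 : Tendsto (fun n : ℕ => 1 * (1 / 2 : ℝ) ^ n / (1 - 1 / 2)) atTop (𝓝 0) := by
        have := (tendsto_pow_atTop_nhds_zero_of_lt_one (r := (1 / 2 : ℝ))
          (by norm_num) (by norm_num)).const_mul 1 |>.div_const (1 - 1 / 2 : ℝ)
        simpa using this
      filter_upwards [h0.eventually (gt_mem_nhds hε)] with n hn c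
      rw [dist_comm]
      refine lt_of_le_of_lt (dist_le_of_le_geometric_of_tendsto (1 / 2) 1 (by norm_num)
        (fun n => ?_) (hΦ c) n) hn
      rw [one_mul]
      exact hdist (initSeg c n) (c n) n (length_initSeg c n).le
    · have hinit : Continuous fun c => initSeg c n := by
        clear * -
        induction n with
        | zero => exact continuous_const
        | succ n ih =>
          have : Continuous fun c : ℕ → Bool => (c n, initSeg c n) :=
            (continuous_apply n).prodMk ih
          exact (continuous_of_discreteTopology
            (f := fun p : Bool × List Bool => p.1 :: p.2)).comp this
      exact (continuous_of_discreteTopology (f := q n)).comp hinit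
  refine ⟨fun c => (Φ c).1, continuous_fst.comp hΦcont, fun k c => ?_⟩
  -- The edge codes converge as well, so by continuity of `g` the limiting pair is still in its
  -- range `G`, although `G` need not be closed.
  obtain ⟨d, hd⟩ : ∃ d, Tendsto (fun m => q (k + 1 + m) (initSeg c m)) atTop (𝓝 d) := by
    refine cauchySeq_tendsto_of_complete (cauchySeq_of_le_geometric (1 / 2) 1 (by norm_num)
      fun m => ?_)
    refine (hdist (initSeg c m) (c m) (k + 1 + m) (by simp)).trans ?_
    rw [one_mul]
    exact pow_le_pow_of_le_one (by norm_num) (by norm_num) (by omega)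
  have hvert : ∀ i : Bool, Tendsto (fun m => (q (k + 1 + m) (initSeg c m ++ i :: s k)).1) atTop
      (𝓝 (Φ (glue (i :: s k) c)).1) := by
    intro i
    have h := (hΦ (glue (i :: s k) c)).comp (tendsto_add_atTop_nat (k + 1))
    refine ((continuous_fst.tendsto _).comp h).congr fun m => ?_
    have hlen : m + (k + 1) = (i :: s k).length + m := by simp [hs]; omega
    simp only [Function.comp_apply]
    rw [hlen, initSeg_glue]
    simp [hs]
  have hedge : ∀ m, g (q (k + 1 + m) (initSeg c m)).2 =
      ((q (k + 1 + m) (initSeg c m ++ false :: s k)).1,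
        (q (k + 1 + m) (initSeg c m ++ true :: s k)).1) := by
    intro m
    have := append_mem_of_forall_mem_extend (Q := fun n => (Q n).1) hQ (initSeg c m)
      (n := k + 1) (q := q (k + 1 + m)) (by
        rw [length_initSeg]
        exact hq (k + 1 + m))
    simpa using (hQ k this).2
  have h1 : Tendsto (fun m => g (q (k + 1 + m) (initSeg c m)).2) atTop (𝓝 (g d.2)) :=
    ((hg.comp continuous_snd).tendsto d).comp hd
  have h2 := tendsto_nhds_unique (h1.congr hedge) ((hvert false).prodMk_nhds (hvert true))
  rw [← hgG]
  exact ⟨d.2, h2⟩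

/-- The edges connect any two words of the same length followed by a common tail, by induction
through `s n`. Thus `ψ` is constant on tail-equivalence classes, which are dense. -/
theorem eq_of_forall_glue_eq {X : Type*} [TopologicalSpace X] [T2Space X] {s : ℕ → List Bool}
    (hs : ∀ n, (s n).length = n) {ψ : (ℕ → Bool) → X} (hψ : Continuous ψ)
    (h : ∀ n c, ψ (glue (false :: s n) c) = ψ (glue (true :: s n) c)) (c c' : ℕ → Bool) :
    ψ c = ψ c' := by
  have key : ∀ n (t t' : List Bool), t.length = n → t'.length = n →
      ∀ c, ψ (glue t c) = ψ (glue t' c) := by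
    intro n
    induction n with
    | zero =>
      intro t t' ht ht' c
      rw [List.length_eq_zero_iff.1 ht, List.length_eq_zero_iff.1 ht']
    | succ n ih =>
      intro t t' ht ht' c
      match t, t', ht, ht' with
      | i :: t, j :: t', ht, ht' =>
        have h1 : ψ (glue (i :: t) c) = ψ (glue (i :: s n) c) :=
          ih t (s n) (by simpa using ht) (hs n) _
        have h2 : ψ (glue (j :: t') c) = ψ (glue (j :: s n) c) :=
          ih t' (s n) (by simpa using ht') (hs n) _
        rw [h1, h2]
        cases i <;> cases j <;> simp [h]
  have hlim := (hψ.tendsto c').comp (tendsto_glue_initSeg c' fun n m => c (n + m))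
  refine tendsto_nhds_unique (hlim.congr fun n => ?_) tendsto_const_nhds |>.symm
  change ψ (glue (initSeg c' n) fun m => c (n + m)) = ψ c
  rw [key n (initSeg c' n) (initSeg c n) (by simp) (by simp), glue_initSeg]

/-! ### Splitting `R` into Borel sets with single-class sections -/

/-- Each vertical section of `S` is contained in a single `F`-class. -/
def SingleClassSections {X Y : Type*} (F : Setoid Y) (S : Set (X × Y)) : Prop :=
  ∀ x y y', (x, y) ∈ S → (x, y') ∈ S → F y y'

/-- The vertical sections of `S` are `F`-invariant. -/
def InvariantSections {X Y : Type*} (F : Setoid Y) (S : Set (X × Y)) : Prop :=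
  ∀ x y y', (x, y) ∈ S → F y y' → (x, y') ∈ S

theorem invariantSections_of_sUnion {X Y : Type*} {F : Setoid Y} {R : Set (X × Y)}
    (hsec : ∀ x : X, ∃ C ⊆ F.classes, verticalSection R x = ⋃₀ C) :
    InvariantSections F R := by
  intro x y y' hy hyy'
  obtain ⟨C, hC, hRC⟩ := hsec x
  have hy : y ∈ verticalSection R x := hy
  change y' ∈ verticalSection R x
  rw [hRC] at hy ⊢
  obtain ⟨K, hK, hyK⟩ := hy
  obtain ⟨z, rfl⟩ := hC hK
  exact ⟨_, hK, F.trans (F.symm hyy') hyK⟩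

/-- The graph joining points of `R` with the same first and `F`-inequivalent second
coordinates. -/
def inequivGraph {X Y : Type*} (F : Setoid Y) (R : Set (X × Y)) : Set ((X × Y) × (X × Y)) :=
  {p | p.1 ∈ R ∧ p.2 ∈ R ∧ p.1.1 = p.2.1 ∧ ¬ F p.1.2 p.2.2}

theorem inequivGraph_symm {X Y : Type*} {F : Setoid Y} {R : Set (X × Y)} (a b : X × Y)
    (h : (a, b) ∈ inequivGraph F R) : (b, a) ∈ inequivGraph F R :=
  ⟨h.2.1, h.1, h.2.2.1.symm, fun hF => h.2.2.2 (F.symm hF)⟩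

theorem measurableSet_inequivGraph {X Y : Type*} [TopologicalSpace X] [PolishSpace X]
    [MeasurableSpace X] [BorelSpace X] [MeasurableSpace Y] {F : Setoid Y} (hF : IsBorelEquiv F) {R : Set (X × Y)}
    (hR : MeasurableSet R) : MeasurableSet (inequivGraph F R) := by
  refine (measurable_fst hR).inter ((measurable_snd hR).inter (MeasurableSet.inter ?_ ?_))
  · exact measurableSet_eq_fun (measurable_fst.comp measurable_fst)
      (measurable_fst.comp measurable_snd)
  · exact ((measurable_snd.comp measurable_fst).prodMk (measurable_snd.comp measurable_snd)
      hF).compl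

theorem IsIndependent.singleClassSections {X Y : Type*} {F : Setoid Y} {R S : Set (X × Y)}
    (hS : IsIndependent (inequivGraph F R) S) : SingleClassSections F (S ∩ R) := by
  rintro x y y' ⟨hy, hyR⟩ ⟨hy', hyR'⟩
  by_contra h
  exact hS _ hy _ hy' ⟨hyR, hyR', rfl, h⟩

section Polish

variable {X Y : Type*}
  [TopologicalSpace X] [PolishSpace X] [MeasurableSpace X] [BorelSpace X]
  [TopologicalSpace Y] [PolishSpace Y] [MeasurableSpace Y] [BorelSpace Y]

theorem exists_cover_singleClassSections {F : Setoid Y} (hF : IsBorelEquiv F) {R : Set (X × Y)}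
    (hR : MeasurableSet R)
    (hsec : ∀ x : X, ∃ C : Set (Set Y), C.Countable ∧ C ⊆ F.classes ∧
      verticalSection R x = ⋃₀ C) :
    ∃ B : ℕ → Set (X × Y), (∀ i, MeasurableSet (B i) ∧ SingleClassSections F (B i)) ∧
      ⋃ i, B i = R := by
  obtain ⟨s, hs, hsd⟩ := exists_dense_seq
  obtain ⟨B, hB, hcov⟩ | ⟨φ, hφ, hφG⟩ := exists_cover_isIndependent_or_exists_continuous
    (measurableSet_inequivGraph hF hR) inequivGraph_symm hs
  · refine ⟨fun i => B i ∩ R, fun i => ⟨(hB i).1.inter hR, (hB i).2.singleClassSections⟩, ?_⟩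
    rw [← iUnion_inter, hcov, univ_inter]
  exfalso
  have hconst := eq_of_forall_glue_eq hs (continuous_fst.comp hφ) fun n c => (hφG n c).2.2.1
  let c₀ : ℕ → Bool := fun _ => false
  obtain ⟨C, hC, hCF, hRC⟩ := hsec (φ c₀).1
  have : Countable C := hC.to_subtype
  have hsnd : Measurable fun c => (φ c).2 := (continuous_snd.comp hφ).measurable
  -- The index `none` takes the points sent outside `R`, which are never endpoints of edges.
  obtain ⟨i, n, c, h1, h2⟩ := exists_glue_mem_of_cover hsd
    (A := fun K : Option C => K.elim (φ ⁻¹' Rᶜ) fun K => (fun c => (φ c).2) ⁻¹' K.1) (by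
      rintro (_ | ⟨K, hK⟩)
      · exact hφ.measurable hR.compl
      · obtain ⟨z, rfl⟩ := hCF hK
        exact hsnd ((measurable_id.prodMk measurable_const) hF)) (by
      refine eq_univ_of_forall fun c => ?_
      by_cases hc : φ c ∈ R
      · have : (φ c).2 ∈ verticalSection R (φ c₀).1 := by
          have h : (φ c).1 = (φ c₀).1 := hconst c c₀
          change ((φ c₀).1, (φ c).2) ∈ R
          rw [← h]
          exact hc
        rw [hRC] at this
        obtain ⟨K, hK, hcK⟩ := this
        exact mem_iUnion.2 ⟨some ⟨K, hK⟩, hcK⟩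
      · exact mem_iUnion.2 ⟨none, hc⟩)
  rcases i with _ | ⟨K, hK⟩
  · exact h1 (hφG n c).1
  · obtain ⟨z, rfl⟩ := hCF hK
    exact (hφG n c).2.2.2 (F.trans h1 (F.symm h2))

/-- The saturation of `B` is a priori only analytic, but it is independent for `inequivGraph F R`,
so it has a Borel independent superset. -/
theorem exists_measurableSet_saturation_subset {F : Setoid Y} (hF : IsBorelEquiv F)
    {R : Set (X × Y)} (hR : MeasurableSet R) (hinv : InvariantSections F R) {B : Set (X × Y)}
    (hB : MeasurableSet B) (hBs : SingleClassSections F B) (hBR : B ⊆ R) :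
    ∃ S ⊆ R, MeasurableSet S ∧ SingleClassSections F S ∧
      ∀ x y y', (x, y) ∈ B → F y y' → (x, y') ∈ S := by
  have hH : MeasurableSet {p : (X × Y) × (X × Y) | p.1.1 = p.2.1 ∧ F p.1.2 p.2.2} :=
    (measurableSet_eq_fun (measurable_fst.comp measurable_fst)
      (measurable_fst.comp measurable_snd)).inter
      ((measurable_snd.comp measurable_fst).prodMk (measurable_snd.comp measurable_snd) hF)
  obtain ⟨S, hsub, hS, hSi⟩ := exists_measurableSet_isIndependent_superset
    (measurableSet_inequivGraph hF hR) inequivGraph_symm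
    (analyticSet_relImage hH hB.analyticSet) (by
      rintro _ ⟨⟨⟨x, a⟩, ⟨x', a'⟩⟩, ⟨⟨hx, haa'⟩, ha⟩, rfl⟩
        _ ⟨⟨⟨z, b⟩, ⟨z', b'⟩⟩, ⟨⟨hz, hbb'⟩, hb⟩, rfl⟩ ⟨-, -, hxz, hn⟩
      obtain rfl : x = z := (hx.trans hxz).trans hz.symm
      exact hn (F.trans (F.symm haa') (F.trans (hBs _ _ _ ha hb) hbb')))
  refine ⟨S ∩ R, inter_subset_right, hS.inter hR, hSi.singleClassSections, ?_⟩
  exact fun x y y' hy hyy' =>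
    ⟨hsub ⟨((x, y), (x, y')), ⟨⟨rfl, hyy'⟩, hy⟩, rfl⟩, hinv x y y' (hBR hy) hyy'⟩

/-- Each Borel set in the iteration contains the saturation of the previous one, so the increasing
union is invariant. -/
theorem exists_measurableSet_invariantSections_superset {F : Setoid Y} (hF : IsBorelEquiv F)
    {R : Set (X × Y)} (hR : MeasurableSet R) (hinv : InvariantSections F R) {B : Set (X × Y)}
    (hB : MeasurableSet B) (hBs : SingleClassSections F B) (hBR : B ⊆ R) :
    ∃ S ⊆ R, B ⊆ S ∧ MeasurableSet S ∧ SingleClassSections F S ∧ InvariantSections F S := by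
  let P : Set (X × Y) → Prop := fun S => S ⊆ R ∧ MeasurableSet S ∧ SingleClassSections F S
  have step : ∀ S : {S // P S}, ∃ T : {T // P T},
      ∀ x y y', (x, y) ∈ S.1 → F y y' → (x, y') ∈ T.1 := by
    rintro ⟨S, hSR, hS, hSs⟩
    obtain ⟨T, hTR, hT, hTs, h⟩ := exists_measurableSet_saturation_subset hF hR hinv hS hSs hSR
    exact ⟨⟨T, hTR, hT, hTs⟩, h⟩
  choose next hnext using step
  let S : ℕ → {S // P S} := fun n => next^[n] ⟨B, hBR, hB, hBs⟩
  have hS : ∀ n x y y', (x, y) ∈ (S n).1 → F y y' → (x, y') ∈ (S (n + 1)).1 := by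
    intro n
    have : S (n + 1) = next (S n) := Function.iterate_succ_apply' _ _ _
    rw [this]
    exact hnext (S n)
  have hmono : Monotone fun n => (S n).1 :=
    monotone_nat_of_le_succ fun n p hp => hS n p.1 p.2 p.2 hp (F.refl _)
  refine ⟨⋃ n, (S n).1, iUnion_subset fun n => (S n).2.1, subset_iUnion (fun n => (S n).1) 0,
    MeasurableSet.iUnion fun n => (S n).2.2.1, ?_, ?_⟩
  · intro x y y' hy hy'
    obtain ⟨n, hn⟩ := mem_iUnion.1 hy
    obtain ⟨m, hm⟩ := mem_iUnion.1 hy'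
    exact (S (max n m)).2.2.2 x y y' (hmono (le_max_left n m) hn) (hmono (le_max_right n m) hm)
  · intro x y y' hy hyy'
    obtain ⟨n, hn⟩ := mem_iUnion.1 hy
    exact mem_iUnion.2 ⟨n + 1, hS n x y y' hn hyy'⟩

end Polish

/-! ### Uniformization -/

theorem exists_isClosed_scheme {W : Type*} [TopologicalSpace W] [PolishSpace W] {S : Set W}
    (hS : IsClosed S) :
    ∃ B : ℕ → ℕ → Set W, (∀ n i, IsClosed (B n i)) ∧ (∀ n, ⋃ i, B n i = univ) ∧
      (∀ a : ℕ → ℕ, ∀ w w', (∀ n, w ∈ B n (a n)) → (∀ n, w' ∈ B n (a n)) → w = w') ∧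
      ∀ (a : ℕ → ℕ) (p : ℕ → W), (∀ n, p n ∈ S ∧ ∀ k < n, p n ∈ B k (a k)) →
        ∃ w ∈ S, (∀ k, w ∈ B k (a k)) ∧ Tendsto p atTop (𝓝 w) := by
  rcases isEmpty_or_nonempty W with hW | hW
  · exact ⟨fun _ _ => ∅, fun _ _ => isClosed_empty, fun _ => Subsingleton.elim _ _,
      fun _ w => isEmptyElim w, fun _ p => isEmptyElim (p 0)⟩
  let _ := TopologicalSpace.upgradeIsCompletelyMetrizable W
  let v := TopologicalSpace.denseSeq W
  have hlim : Tendsto (fun n : ℕ => 2 * (1 / 2 : ℝ) ^ n) atTop (𝓝 0) := by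
    simpa using (tendsto_pow_atTop_nhds_zero_of_lt_one (r := (1 / 2 : ℝ))
      (by norm_num) (by norm_num)).const_mul 2
  have hball : ∀ (n i : ℕ) (w w' : W), w ∈ Metric.closedBall (v i) ((1 / 2) ^ n) →
      w' ∈ Metric.closedBall (v i) ((1 / 2) ^ n) → dist w w' ≤ 2 * (1 / 2 : ℝ) ^ n := by
    intro n i w w' hw hw'
    rw [Metric.mem_closedBall] at hw hw'
    linarith [dist_triangle_right w w' (v i)]
  refine ⟨fun n i => Metric.closedBall (v i) ((1 / 2) ^ n), fun n i => Metric.isClosed_closedBall,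
    fun n => eq_univ_of_forall fun w => ?_, fun a w w' hw hw' => ?_, fun a p hp => ?_⟩
  · have hpos : (0 : ℝ) < (1 / 2) ^ n := by positivity
    obtain ⟨i, hi⟩ := (TopologicalSpace.denseRange_denseSeq W).exists_mem_open
      (Metric.isOpen_ball (x := w) (ε := (1 / 2 : ℝ) ^ n)) ⟨w, Metric.mem_ball_self hpos⟩
    refine mem_iUnion.2 ⟨i, ?_⟩
    rw [Metric.mem_closedBall, dist_comm]
    exact (Metric.mem_ball.1 hi).le
  · refine dist_le_zero.1 (ge_of_tendsto' hlim fun n => hball n (a n) w w' (hw n) (hw' n))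
  · have hcauchy : CauchySeq p := by
      rw [Metric.cauchySeq_iff']
      intro ε hε
      obtain ⟨N, hN⟩ := (hlim.eventually (gt_mem_nhds hε)).exists
      -- `p n` is known to lie in the level-`N` ball only for `n > N`.
      refine ⟨N + 1, fun n hn => lt_of_le_of_lt ?_ hN⟩
      exact hball N (a N) _ _ ((hp n).2 N (by omega)) ((hp (N + 1)).2 N (by omega))
    obtain ⟨w, hw⟩ := cauchySeq_tendsto_of_complete hcauchy
    refine ⟨w, hS.mem_of_tendsto hw (Eventually.of_forall fun n => (hp n).1), fun k => ?_, hw⟩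
    refine Metric.isClosed_closedBall.mem_of_tendsto hw ?_
    filter_upwards [eventually_gt_atTop k] with n hn using (hp n).2 k hn

/-- A finer Polish topology with the same Borel sets makes `S` closed, so limits stay in `S`;
convergence passes to the original topology. -/
theorem exists_measurableSet_scheme {W : Type*} [t : TopologicalSpace W] [ht : PolishSpace W]
    [MeasurableSpace W] [BorelSpace W] {S : Set W} (hS : MeasurableSet S) :
    ∃ B : ℕ → ℕ → Set W, (∀ n i, MeasurableSet (B n i)) ∧ (∀ n, ⋃ i, B n i = univ) ∧
      (∀ a : ℕ → ℕ, ∀ w w', (∀ n, w ∈ B n (a n)) → (∀ n, w' ∈ B n (a n)) → w = w') ∧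
      ∀ (a : ℕ → ℕ) (p : ℕ → W), (∀ n, p n ∈ S ∧ ∀ k < n, p n ∈ B k (a k)) →
        ∃ w ∈ S, (∀ k, w ∈ B k (a k)) ∧ Tendsto p atTop (𝓝 w) := by
  obtain ⟨t', hle, hpol, hcl, -⟩ := hS.isClopenable
  obtain ⟨B, hB, hcov, huniq, hlim⟩ := @exists_isClosed_scheme W t' hpol S hcl
  refine ⟨B, fun n i => ?_, hcov, huniq, fun a p hp => ?_⟩
  · rw [@BorelSpace.measurable_eq W t _ _, ← borel_eq_borel_of_le hpol ht hle]
    exact @IsClosed.measurableSet W _ t' (borel W)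
      (@BorelSpace.opensMeasurable W t' (borel W) (@BorelSpace.mk W t' (borel W) rfl)) (hB n i)
  · obtain ⟨w, hw, hwB, hpw⟩ := hlim a p hp
    exact ⟨w, hw, hwB, hpw.mono_right (nhds_mono hle)⟩

/-! ### Selecting a point of each class by means of the ideals -/

section Refine

variable {X Y : Type*}

/-- The restriction of `T` to the points whose last two coordinates lie in `B`. -/
def cut (B : Set (X × Y)) (T : Set ((Y × X) × Y)) : Set ((Y × X) × Y) :=
  {q | q ∈ T ∧ (q.1.2, q.2) ∈ B}

/-- Each section of `T` is intersected with the section of the first `B i` for which the result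
is positive for the relevant ideal. -/
def refineFirst (I : Y → Set (Set Y)) (B : ℕ → Set (X × Y)) (T : Set ((Y × X) × Y)) :
    Set ((Y × X) × Y) :=
  {q | ∃ i, q ∈ cut (B i) T ∧ verticalSection (cut (B i) T) q.1 ∉ I q.1.1 ∧
    ∀ j < i, verticalSection (cut (B j) T) q.1 ∈ I q.1.1}

/-- Iterated refinement along a sequence of covers, starting from the sections of `S`. -/
def refineIter (I : Y → Set (Set Y)) (B : ℕ → ℕ → Set (X × Y)) (S : Set (X × Y)) :
    ℕ → Set ((Y × X) × Y)
  | 0 => {q | (q.1.2, q.2) ∈ S}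
  | n + 1 => refineFirst I (B n) (refineIter I B S n)

theorem verticalSection_refineFirst_congr {I : Y → Set (Set Y)} {B : ℕ → Set (X × Y)}
    {T : Set ((Y × X) × Y)} {x : X} {y y' : Y} (hI : I y = I y')
    (hT : verticalSection T (y, x) = verticalSection T (y', x)) :
    verticalSection (refineFirst I B T) (y, x) = verticalSection (refineFirst I B T) (y', x) := by
  have hmem : ∀ z, ((y, x), z) ∈ T ↔ ((y', x), z) ∈ T := fun z => Set.ext_iff.1 hT z
  have hcut : ∀ i, verticalSection (cut (B i) T) (y, x) =
      verticalSection (cut (B i) T) (y', x) := by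
    intro i
    ext z
    exact and_congr (hmem z) Iff.rfl
  ext z
  change (∃ i, z ∈ verticalSection (cut (B i) T) (y, x) ∧ _ ∧ _) ↔
    (∃ i, z ∈ verticalSection (cut (B i) T) (y', x) ∧ _ ∧ _)
  simp only [hcut, hI]

theorem verticalSection_refineIter_congr {I : Y → Set (Set Y)} {B : ℕ → ℕ → Set (X × Y)}
    {S : Set (X × Y)} {x : X} {y y' : Y} (hI : I y = I y') (n : ℕ) :
    verticalSection (refineIter I B S n) (y, x) =
      verticalSection (refineIter I B S n) (y', x) := by
  induction n with
  | zero => rfl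
  | succ n ih => exact verticalSection_refineFirst_congr hI ih

/-- Countably many pieces in a σ-ideal cannot cover a positive section, so a first positive piece
exists. -/
theorem exists_verticalSection_refineFirst {I : Y → Set (Set Y)} (hI : ∀ y, IsSigmaIdeal (I y))
    {B : ℕ → Set (X × Y)} (hB : ⋃ i, B i = univ) {T : Set ((Y × X) × Y)} {p : Y × X}
    (hT : verticalSection T p ∉ I p.1) :
    verticalSection (refineFirst I B T) p ∉ I p.1 ∧
      ∃ i, verticalSection (refineFirst I B T) p = verticalSection (cut (B i) T) p := by
  classical
  have hex : ∃ i, verticalSection (cut (B i) T) p ∉ I p.1 := by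
    by_contra! h
    refine hT ?_
    convert (hI p.1).iUnion_mem _ h using 1
    ext z
    simp only [mem_iUnion]
    constructor
    · intro hz
      obtain ⟨i, hi⟩ := mem_iUnion.1 (hB.ge (mem_univ (p.2, z)))
      exact ⟨i, hz, hi⟩
    · rintro ⟨i, hz, -⟩
      exact hz
  have heq : verticalSection (refineFirst I B T) p =
      verticalSection (cut (B (Nat.find hex)) T) p := by
    ext z
    constructor
    · rintro ⟨i, hz, hi, hlt⟩
      rwa [(Nat.find_eq_iff hex).2 ⟨hi, fun j hj => not_not.2 (hlt j hj)⟩]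
    · exact fun hz => ⟨_, hz, Nat.find_spec hex, fun j hj => not_not.1 (Nat.find_min hex hj)⟩
  exact ⟨heq ▸ Nat.find_spec hex, _, heq⟩

end Refine

section Polish

variable {X Y : Type*}
  [TopologicalSpace X] [PolishSpace X] [MeasurableSpace X] [BorelSpace X] [MeasurableSpace Y]

theorem measurableSet_refineFirst {I : Y → Set (Set Y)} (hI : StronglyBorelOnBorel I)
    {B : ℕ → Set (X × Y)} (hB : ∀ i, MeasurableSet (B i)) {T : Set ((Y × X) × Y)}
    (hT : MeasurableSet T) : MeasurableSet (refineFirst I B T) := by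
  have hcut : ∀ i, MeasurableSet (cut (B i) T) := fun i =>
    hT.inter (((measurable_snd.comp measurable_fst).prodMk measurable_snd) (hB i))
  have hE : ∀ i, MeasurableSet {q : (Y × X) × Y |
      verticalSection (cut (B i) T) q.1 ∈ I q.1.1} := fun i =>
    measurable_fst (hI.measurableSet X _ (hcut i))
  have : refineFirst I B T = ⋃ i, cut (B i) T ∩
      ({q | verticalSection (cut (B i) T) q.1 ∈ I q.1.1}ᶜ ∩
        ⋂ j, ⋂ _ : j < i, {q | verticalSection (cut (B j) T) q.1 ∈ I q.1.1}) := by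
    ext q
    simp [refineFirst]
  rw [this]
  exact MeasurableSet.iUnion fun i => (hcut i).inter ((hE i).compl.inter
    (MeasurableSet.iInter fun j => MeasurableSet.iInter fun _ => hE j))

theorem measurableSet_refineIter {I : Y → Set (Set Y)} (hI : StronglyBorelOnBorel I)
    {B : ℕ → ℕ → Set (X × Y)} (hB : ∀ n i, MeasurableSet (B n i)) {S : Set (X × Y)}
    (hS : MeasurableSet S) (n : ℕ) : MeasurableSet (refineIter I B S n) := by
  induction n with
  | zero => exact ((measurable_snd.comp measurable_fst).prodMk measurable_snd) hS
  | succ n ih => exact measurableSet_refineFirst hI (hB n) ih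

variable [TopologicalSpace Y] [PolishSpace Y] [BorelSpace Y]

/-- A Borel set each of whose nonempty vertical sections is a class of a strongly idealistic
equivalence relation has a Borel uniformization. -/
theorem exists_uniformization_of_class_sections {F : Setoid Y} (hFi : IsStronglyIdealistic F)
    {S : Set (X × Y)} (hS : MeasurableSet S) (hSs : SingleClassSections F S)
    (hSi : InvariantSections F S) :
    ∃ D ⊆ S, MeasurableSet D ∧ (∀ x y y', (x, y) ∈ D → (x, y') ∈ D → y = y') ∧
      ∀ x y, (x, y) ∈ S → ∃ y', (x, y') ∈ D := by
  obtain ⟨I, hideal, hinv, hborel, hpos⟩ := hFi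
  obtain ⟨B, hB, hcov, huniq, hlim⟩ := exists_measurableSet_scheme hS
  set T := refineIter I B S with hTdef
  have hsection : ∀ x y, (x, y) ∈ S → ∃ y₀, (x, y₀) ∈ S ∧
      ∀ y', (∀ n, ((y, x), y') ∈ T n) ↔ y' = y₀ := by
    intro x y hxy
    have hTpos : ∀ n, verticalSection (T n) (y, x) ∉ I y := by
      intro n
      induction n with
      | zero =>
        -- The initial section is all of `[y]_F`.
        convert hpos y using 2
        ext z
        exact ⟨fun hz => hSs x z y hz hxy, fun hz => hSi x y z hxy (F.symm hz)⟩
      | succ n ih => exact (exists_verticalSection_refineFirst hideal (hcov n) (p := (y, x)) ih).1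
    choose a ha using fun n =>
      (exists_verticalSection_refineFirst hideal (hcov n) (p := (y, x)) (hTpos n)).2
    have hmem : ∀ n z, ((y, x), z) ∈ T n ↔ (x, z) ∈ S ∧ ∀ k < n, (x, z) ∈ B k (a k) := by
      intro n z
      induction n with
      | zero => simp [hTdef, refineIter]
      | succ n ih =>
        have h : ((y, x), z) ∈ T (n + 1) ↔ ((y, x), z) ∈ T n ∧ (x, z) ∈ B n (a n) :=
          Set.ext_iff.1 (ha n) z
        rw [h, ih, Nat.forall_lt_succ_right, and_assoc]
    have hne : ∀ n, (verticalSection (T n) (y, x)).Nonempty := by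
      intro n
      by_contra h
      rw [not_nonempty_iff_eq_empty] at h
      exact hTpos n (h ▸ (hideal y).empty_mem)
    choose z hz using hne
    obtain ⟨⟨x', y₀⟩, hwS, hwB, hw⟩ := hlim a (fun n => (x, z n)) fun n => (hmem n _).1 (hz n)
    obtain rfl : x' = x :=
      tendsto_nhds_unique ((continuous_fst.tendsto _).comp hw) tendsto_const_nhds
    refine ⟨y₀, hwS, fun y' => ⟨fun h => ?_, ?_⟩⟩
    · have := huniq a (x', y') (x', y₀)
        (fun n => ((hmem (n + 1) y').1 (h (n + 1))).2 n n.lt_succ_self) hwB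
      exact congrArg Prod.snd this
    · rintro rfl n
      exact (hmem n _).2 ⟨hwS, fun k _ => hwB k⟩
  -- On this diagonal `y` is both the index of the ideal and the candidate point. As the sections
  -- depend only on the class of the index, no quantifier over the class is needed and the set is
  -- Borel.
  refine ⟨S ∩ ⋂ n, (fun q : X × Y => ((q.2, q.1), q.2)) ⁻¹' T n, inter_subset_left,
    hS.inter (MeasurableSet.iInter fun n => ?_), ?_, ?_⟩
  · exact ((measurable_snd.prodMk measurable_fst).prodMk measurable_snd)
      (measurableSet_refineIter hborel hB hS n)
  · rintro x y y' ⟨hy, hyT⟩ ⟨hy', hyT'⟩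
    obtain ⟨y₀, -, h₀⟩ := hsection x y hy
    rw [(h₀ y).1 fun n => mem_iInter.1 hyT n, (h₀ y').1 fun n => ?_]
    exact (Set.ext_iff.1 (verticalSection_refineIter_congr (hinv y y' (hSs x y y' hy hy')) n)
      y').2 (mem_iInter.1 hyT' n)
  · intro x y hy
    obtain ⟨y₀, hy₀, h₀⟩ := hsection x y hy
    refine ⟨y₀, hy₀, mem_iInter.2 fun n => ?_⟩
    exact (Set.ext_iff.1 (verticalSection_refineIter_congr (hinv y y₀ (hSs x y y₀ hy hy₀)) n)
      y₀).1 ((h₀ y₀).2 rfl n)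

/-- The first projection is injective on `D`, so Lusin–Souslin applies to `D` and to each `D ∩
Prod.snd ⁻¹' A`. -/
theorem exists_measurable_of_functional {D : Set (X × Y)} (hD : MeasurableSet D)
    (hfun : ∀ x y y', (x, y) ∈ D → (x, y') ∈ D → y = y') :
    MeasurableSet (Prod.fst '' D) ∧ ∃ φ : (Prod.fst '' D : Set X) → Y, Measurable φ ∧
      ∀ x : (Prod.fst '' D : Set X), ((x : X), φ x) ∈ D := by
  have himage : ∀ D' ⊆ D, MeasurableSet D' → MeasurableSet (Prod.fst '' D') := by
    intro D' hsub hD'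
    refine hD'.image_of_measurable_injOn measurable_fst ?_
    rintro ⟨x, y⟩ hy ⟨x', y'⟩ hy' (rfl : x = x')
    rw [hfun x y y' (hsub hy) (hsub hy')]
  have hex : ∀ x : (Prod.fst '' D : Set X), ∃ y, ((x : X), y) ∈ D := by
    rintro ⟨_, ⟨x, y⟩, hxy, rfl⟩
    exact ⟨y, hxy⟩
  choose φ hφ using hex
  refine ⟨himage D Subset.rfl hD, φ, fun A hA => ?_, hφ⟩
  convert measurable_subtype_coe
    (himage (D ∩ Prod.snd ⁻¹' A) inter_subset_left (hD.inter (measurable_snd hA))) using 1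
  ext x
  constructor
  · exact fun hx => ⟨(x, φ x), ⟨hφ x, hx⟩, rfl⟩
  · rintro ⟨⟨x', y⟩, ⟨hxy, hy⟩, (rfl : x' = x)⟩
    have : φ x = y := hfun _ _ _ (hφ x) hxy
    rwa [mem_preimage, this]

/-- Extend countably many functional sets to the union of their projections. -/
theorem exists_functional_extension {D : ℕ → Set (X × Y)} (hD : ∀ n, MeasurableSet (D n))
    (hfun : ∀ n x y y', (x, y) ∈ D n → (x, y') ∈ D n → y = y') (n : ℕ) :
    ∃ D' ⊆ ⋃ m, D m, D n ⊆ D' ∧ MeasurableSet D' ∧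
      (∀ x y y', (x, y) ∈ D' → (x, y') ∈ D' → y = y') ∧
      Prod.fst '' D' = Prod.fst '' ⋃ m, D m := by
  classical
  have hproj : ∀ m, MeasurableSet {q : X × Y | q.1 ∈ Prod.fst '' D m} := fun m =>
    measurable_fst (exists_measurable_of_functional (hD m) (hfun m)).1
  -- Off the projection of `D n`, the value comes from the first `D m` defined at the point.
  let E : ℕ → Set (X × Y) := fun m => D m ∩
    ({q | q.1 ∈ Prod.fst '' D n}ᶜ ∩ ⋂ k, ⋂ _ : k < m, {q | q.1 ∈ Prod.fst '' D k}ᶜ)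
  have hE : ∀ x y m, (x, y) ∈ E m ↔ (x, y) ∈ D m ∧ x ∉ Prod.fst '' D n ∧
      ∀ k < m, x ∉ Prod.fst '' D k := by
    intro x y m
    simp only [E, mem_inter_iff, mem_compl_iff, mem_iInter, mem_ofPred_eq]
  have hsub : D n ∪ ⋃ m, E m ⊆ ⋃ m, D m :=
    union_subset (subset_iUnion D n) (iUnion_mono fun m => inter_subset_left)
  refine ⟨D n ∪ ⋃ m, E m, hsub, subset_union_left,
    (hD n).union (MeasurableSet.iUnion fun m => (hD m).inter ((hproj n).compl.inter
      (MeasurableSet.iInter fun k => MeasurableSet.iInter fun _ => (hproj k).compl))), ?_, ?_⟩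
  · intro x y y' hy hy'
    simp only [mem_union, mem_iUnion, hE] at hy hy'
    rcases hy with hy | ⟨m, hy, hn, hm⟩ <;> rcases hy' with hy' | ⟨m', hy', hn', hm'⟩
    · exact hfun n x y y' hy hy'
    · exact absurd ⟨_, hy, rfl⟩ hn'
    · exact absurd ⟨_, hy', rfl⟩ hn
    · obtain h | rfl | h := lt_trichotomy m m'
      · exact absurd ⟨_, hy, rfl⟩ (hm' m h)
      · exact hfun m x y y' hy hy'
      · exact absurd ⟨_, hy', rfl⟩ (hm m' h)
  · refine Subset.antisymm (image_mono hsub) ?_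
    rintro _ ⟨⟨x, y⟩, hxy, rfl⟩
    obtain ⟨m, hm⟩ := mem_iUnion.1 hxy
    by_cases hn : x ∈ Prod.fst '' D n
    · exact image_mono subset_union_left hn
    have hex : ∃ m, x ∈ Prod.fst '' D m := ⟨m, _, hm, rfl⟩
    obtain ⟨⟨x', y'⟩, hy', (rfl : x' = x)⟩ := Nat.find_spec hex
    exact ⟨(x', y'), Or.inr (mem_iUnion.2 ⟨Nat.find hex, (hE _ _ _).2
      ⟨hy', hn, fun k hk => Nat.find_min hex hk⟩⟩), rfl⟩

end Polish

end BorelQuotient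

theorem mainTheorem6 {X : Type*} {Y : Type*}
    [TopologicalSpace X] [PolishSpace X] [MeasurableSpace X] [BorelSpace X]
    [TopologicalSpace Y] [PolishSpace Y] [MeasurableSpace Y] [BorelSpace Y]
    (F : Setoid Y) (hF : BorelQuotient.IsBorelEquiv F)
    (hFi : BorelQuotient.IsStronglyIdealistic F)
    (R : Set (X × Y)) (hR : MeasurableSet R)
    (hsec : ∀ x : X, ∃ C : Set (Set Y), C.Countable ∧ C ⊆ F.classes ∧
      BorelQuotient.verticalSection R x = ⋃₀ C) :
    MeasurableSet (Prod.fst '' R) ∧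
      ∃ φ : ℕ → (Prod.fst '' R : Set X) → Y,
        (∀ n, Measurable (φ n)) ∧
          ∀ x : (Prod.fst '' R : Set X),
            BorelQuotient.verticalSection R (x : X) =
              ⋃ n, BorelQuotient.eqClass F (φ n x) := by
  have hinv : BorelQuotient.InvariantSections F R :=
    BorelQuotient.invariantSections_of_sUnion fun x => by
      obtain ⟨C, -, hC, h⟩ := hsec x
      exact ⟨C, hC, h⟩
  obtain ⟨B, hB, hBR⟩ := BorelQuotient.exists_cover_singleClassSections hF hR hsec
  choose S hSR hBS hS hSs hSi using fun n =>
    BorelQuotient.exists_measurableSet_invariantSections_superset hF hR hinv (hB n).1 (hB n).2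
      (hBR ▸ Set.subset_iUnion B n)
  choose D hDS hD hDf hDex using fun n =>
    BorelQuotient.exists_uniformization_of_class_sections hFi (hS n) (hSs n) (hSi n)
  -- `D n` may be undefined at some points of the projection of `R`; the borrowed values stay in
  -- `R`, so they add no points outside `R_x`.
  choose D' hD'sub hDD' hD' hD'f hD'proj using
    BorelQuotient.exists_functional_extension hD hDf
  have hmem : ∀ x y, (x, y) ∈ R → ∃ n y', (x, y') ∈ D n ∧ F y y' := by
    intro x y hxy
    rw [← hBR] at hxy
    obtain ⟨n, hn⟩ := Set.mem_iUnion.1 hxy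
    obtain ⟨y', hy'⟩ := hDex n x y (hBS n hn)
    exact ⟨n, y', hy', hSs n x y y' (hBS n hn) (hDS n hy')⟩
  have hDR : ⋃ n, D n ⊆ R := Set.iUnion_subset fun n => (hDS n).trans (hSR n)
  have hproj : ∀ n, Prod.fst '' D' n = Prod.fst '' R := by
    intro n
    rw [hD'proj]
    refine Set.Subset.antisymm (Set.image_mono hDR) ?_
    rintro _ ⟨⟨x, y⟩, hxy, rfl⟩
    obtain ⟨m, y', hy', -⟩ := hmem x y hxy
    exact ⟨(x, y'), Set.mem_iUnion.2 ⟨m, hy'⟩, rfl⟩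
  have hφ : ∀ n, MeasurableSet (Prod.fst '' R) ∧ ∃ φ : (Prod.fst '' R : Set X) → Y,
      Measurable φ ∧ ∀ x : (Prod.fst '' R : Set X), ((x : X), φ x) ∈ D' n := fun n =>
    hproj n ▸ BorelQuotient.exists_measurable_of_functional (hD' n) (hD'f n)
  refine ⟨(hφ 0).1, ?_⟩
  choose φ hφm hφD using fun n => (hφ n).2
  refine ⟨φ, hφm, fun x => Set.Subset.antisymm (fun y hy => ?_)
    (Set.iUnion_subset fun n y hy => ?_)⟩
  · obtain ⟨n, y', hy', hyy'⟩ := hmem x y hy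
    rw [hD'f n x y' (φ n x) (hDD' n hy') (hφD n x)] at hyy'
    exact Set.mem_iUnion.2 ⟨n, hyy'⟩
  · exact hinv x (φ n x) y (hDR (hD'sub n (hφD n x))) (F.symm hy)
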